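/- All graphs are finite and simple, and a graph is planar if it can be drawn in the plane, with vertices as distinct points and edges as simple (continuous) arcs joining their endpoints, so that no two edges meet except at a vertex incident to both and no edge passes through a vertex other than its endpoints. For a connected graph $G$ with at least one edge let $\tau(G)$ be the number of spanning trees of $G$, for an edge $e$ let $\tau_G(e)$ be the number of spanning trees of $G$ that contain $e$, put $d_G(e)=\tau_G(e)/\tau(G)$, and let the spanning tree edge dependence of $G$ be $\mathrm{dep}(G)=\max_{e\in E(G)}d_G(e)$. Theorem. (i) Let $G$ be a connected planar graph on $n\ge 2$ vertices. Then $\mathrm{dep}(G)>\frac13$. (ii) Consequently, no rational number $r\le\frac13$ is the dependence of a connected planar graph on at least two vertices. (iii) In particular, Kahl's conjecture that for all positive integers $p<q$ there is a planar graph $G$ with $\mathrm{dep}(G)=p/q$ is false for simple planar graphs. -/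

import Mathlib

universe u

namespace SimpleGraph

variable {V : Type u}

/-- The spanning trees of `G`: a spanning subgraph of `G` has all of `V` as its vertex set, so it
is a graph `T` on `V` with `T ≤ G`. -/
def spanningTrees (G : SimpleGraph V) : Set (SimpleGraph V) :=
  {T | T ≤ G ∧ T.IsTree}

/-- The spanning trees of `G` that contain the edge `e`. -/
def spanningTreesThrough (G : SimpleGraph V) (e : Sym2 V) : Set (SimpleGraph V) :=
  {T | T ∈ G.spanningTrees ∧ e ∈ T.edgeSet}

/-- The number `τ(G)` of spanning trees of `G`. -/
noncomputable def numSpanningTrees (G : SimpleGraph V) : ℕ :=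
  G.spanningTrees.ncard

/-- The number `τ_G(e)` of spanning trees of `G` that contain the edge `e`. -/
noncomputable def numSpanningTreesThrough (G : SimpleGraph V) (e : Sym2 V) : ℕ :=
  (G.spanningTreesThrough e).ncard

/-- The spanning tree edge density `d_G(e) = τ_G(e) / τ(G)`. -/
noncomputable def spanningTreeDensity (G : SimpleGraph V) (e : Sym2 V) : ℝ :=
  (G.numSpanningTreesThrough e : ℝ) / (G.numSpanningTrees : ℝ)

/-- The spanning tree edge dependence `dep(G)`, the maximum of `d_G(e)` over the edges `e`
of `G`. -/
noncomputable def dep (G : SimpleGraph V) : ℝ :=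
  ⨆ e : G.edgeSet, G.spanningTreeDensity (e : Sym2 V)

/-- For a finite graph with at least one edge the supremum defining `dep` is a maximum. -/
theorem isGreatest_dep [Finite V] (G : SimpleGraph V) (h : G.edgeSet.Nonempty) :
    IsGreatest (G.spanningTreeDensity '' G.edgeSet) G.dep := by
  have hfin : (G.spanningTreeDensity '' G.edgeSet).Finite := (Set.toFinite G.edgeSet).image _
  have hdep : G.dep = sSup (G.spanningTreeDensity '' G.edgeSet) := by
    rw [sSup_image']
    rfl
  rw [hdep]
  exact ⟨(h.image _).csSup_mem hfin, fun x hx => le_csSup hfin.bddAbove hx⟩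

/-- A drawing of `G` in the Euclidean plane in which edges meet only at common endpoints:
the vertices are distinct points, every edge is a simple arc joining its two endpoints, an arc
passes through no vertex other than its endpoints, and any common point of two different arcs is
a vertex incident to both edges. -/
structure PlaneDrawing (G : SimpleGraph V) where
  point : V → EuclideanSpace ℝ (Fin 2)
  point_injective : Function.Injective point
  arc : G.edgeSet → unitInterval → EuclideanSpace ℝ (Fin 2)
  arc_continuous : ∀ e, Continuous (arc e)
  arc_injective : ∀ e, Function.Injective (arc e)
  arc_ends : ∀ e : G.edgeSet, s(arc e 0, arc e 1) = (e : Sym2 V).map point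
  incident_of_point_mem_arc : ∀ (e : G.edgeSet) (v : V),
    point v ∈ Set.range (arc e) → v ∈ (e : Sym2 V)
  common_vertex_of_mem_arcs : ∀ e f : G.edgeSet, e ≠ f →
    ∀ x ∈ Set.range (arc e) ∩ Set.range (arc f),
      ∃ v : V, v ∈ (e : Sym2 V) ∧ v ∈ (f : Sym2 V) ∧ point v = x

/-- A graph is planar if it can be drawn in the plane without crossings. -/
def IsPlanar (G : SimpleGraph V) : Prop :=
  Nonempty G.PlaneDrawing

end SimpleGraph

/-- The number `r` is the dependence of some finite simple connected planar graph with at least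
one edge (for a connected graph: with at least two vertices). -/
def IsPlanarDependence (r : ℝ) : Prop :=
  ∃ (V : Type u) (_ : Fintype V) (G : SimpleGraph V),
    2 ≤ Fintype.card V ∧ G.Connected ∧ G.IsPlanar ∧ G.dep = r

/-! ### Continuous logarithms, and why K₅ cannot be drawn. -/

section LogarithmLifts

open Complex

/-! A spanning tree has n - 1 edges, so the densities of the edges sum to n - 1 and some edge has
density at least (n - 1) / |E|. It therefore suffices that a planar graph has fewer than 3(n - 1)
edges, which is weaker than Euler's bound 3n - 6.

This is proved without faces. By induction with deletions and contractions, 3n - 3 edges force a K₅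
minor, recorded as `HasSpreadK5` (`hasSpreadK5_of_ncard_edgeSet`). A plane drawing would turn such a
system of walks into paths in ℂ that contradict `exists_disjoint_paths_meet`. That lemma is a parity
argument: for two disjoint paths the difference γ(s) - δ(t) has a logarithm on the whole square, so
its increments around the boundary cancel. Over the 15 disjoint pairs of edges of K₅ these relations
are inconsistent mod 2. -/

theorem exists_continuous_exp_eq {A : Type*} [TopologicalSpace A] [SimplyConnectedSpace A]
    [LocallyPathConnectedSpace A] {f : A → ℂ} (hf : Continuous f) (h0 : ∀ a, f a ≠ 0) :
    ∃ F : A → ℂ, Continuous F ∧ ∀ a, exp (F a) = f a := by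
  obtain ⟨a₀⟩ : Nonempty A := inferInstance
  obtain ⟨F, ⟨-, hF⟩, -⟩ := isCoveringMapOn_exp.existsUnique_continuousMap_lifts ⟨f, hf⟩
    (a₀ := a₀) (e₀ := log (f a₀)) (by simp [exp_log (h0 a₀)]) (fun a => by simp [h0 a])
  exact ⟨F, F.continuous, fun a => congrFun hF a⟩

theorem eq_of_exp_eq_const {A : Type*} [TopologicalSpace A] [SimplyConnectedSpace A]
    [LocallyPathConnectedSpace A] {H : A → ℂ} (hH : Continuous H) {c : ℂ}
    (hc : ∀ a, exp (H a) = c) (a b : A) : H a = H b := by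
  obtain ⟨F, -, hu⟩ := isCoveringMapOn_exp.existsUnique_continuousMap_lifts
    (A := A) (ContinuousMap.const A c) (a₀ := b) (e₀ := H b) (by simp [hc b])
    (fun x => by simp [← hc x])
  have h1 := hu ⟨H, hH⟩ ⟨rfl, funext fun x => by simp [hc x]⟩
  have h2 := hu (ContinuousMap.const A (H b)) ⟨rfl, funext fun x => by simp [hc b]⟩
  exact congrArg (fun G : C(A, ℂ) => G a) (h1.trans h2.symm)

/-- `F - G` is a continuous logarithm of the constant `c`, hence constant. This compares a logarithm
on a side of a square with one chosen beforehand on that side. -/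
theorem sub_eq_sub_of_exp_eq_mul {A : Type*} [TopologicalSpace A] [SimplyConnectedSpace A]
    [LocallyPathConnectedSpace A] {F G : A → ℂ} (hF : Continuous F) (hG : Continuous G) {c : ℂ}
    (hc : ∀ a, exp (F a) = c * exp (G a)) (a b : A) : F a - F b = G a - G b := by
  have := eq_of_exp_eq_const (H := fun x => F x - G x) (hF.sub hG) (c := c)
    (fun x => by rw [exp_sub, hc, mul_div_assoc, div_self (exp_ne_zero _), mul_one]) a b
  linear_combination this

/-- Two of the ten paths of a drawing of `K₅` in the plane that have no common end meet. -/
theorem exists_disjoint_paths_meet (p : Fin 5 → ℂ) (γ : Fin 5 → Fin 5 → ℝ → ℂ)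
    (hγ : ∀ i j, Continuous (γ i j)) (h0 : ∀ i j, γ i j 0 = p i) (h1 : ∀ i j, γ i j 1 = p j) :
    ∃ i j k l, i ≠ k ∧ i ≠ l ∧ j ≠ k ∧ j ≠ l ∧ ∃ s t, γ i j s = γ k l t := by
  by_contra! hne
  have hp : ∀ i j, i ≠ j → p i ≠ p j := fun i j hij => by
    -- The loops `γ i i` also count as paths, so they separate the points themselves.
    have := hne i i j j hij hij hij hij 0 0
    rwa [h0, h0] at this
  have hpγ : ∀ a i j, a ≠ i → a ≠ j → ∀ t, γ i j t - p a ≠ 0 := fun a i j hi hj t => by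
    have := hne i j a a hi.symm hi.symm hj.symm hj.symm t 0
    rw [h0] at this
    exact sub_ne_zero.2 this
  -- logarithms of the differences of two of the points
  obtain ⟨C, hC, hCC⟩ : ∃ C : Fin 5 → Fin 5 → ℂ, (∀ i j, i ≠ j → exp (C i j) = p j - p i) ∧
      ∀ i j, i < j → C j i = C i j + Real.pi * I := by
    refine ⟨fun i j => if i < j then log (p j - p i) else log (p i - p j) + Real.pi * I,
      fun i j hij => ?_, fun i j hij => by simp [hij, hij.le]⟩
    have h1 : p j - p i ≠ 0 := sub_ne_zero.2 (hp j i hij.symm)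
    have h2 : p i - p j ≠ 0 := sub_ne_zero.2 (hp i j hij)
    by_cases h : i < j
    · simp [h, exp_log h1]
    · simp [h, exp_add, exp_log h2]
  have hL : ∀ a i j, ∃ L : ℝ → ℂ, a ≠ i → a ≠ j →
      Continuous L ∧ ∀ t, exp (L t) = γ i j t - p a := fun a i j => by
    by_cases hi : a = i
    · exact ⟨0, fun h => absurd hi h⟩
    by_cases hj : a = j
    · exact ⟨0, fun _ h => absurd hj h⟩
    obtain ⟨F, hF, hF'⟩ := exists_continuous_exp_eq ((hγ i j).sub continuous_const)
      (hpγ a i j hi hj)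
    exact ⟨F, fun _ _ => ⟨hF, hF'⟩⟩
  choose L hL using hL
  -- `n a i j` is the winding of the path from `p i` to `p j` about `p a`, relative to the fixed
  -- logarithms `C`.
  have hn : ∀ a i j, ∃ n : ℤ, a ≠ i → a ≠ j →
      L a i j 1 - L a i j 0 = C a j - C a i + n * (2 * Real.pi * I) := fun a i j => by
    by_cases hi : a = i
    · exact ⟨0, fun h => absurd hi h⟩
    by_cases hj : a = j
    · exact ⟨0, fun _ h => absurd hj h⟩
    have he : exp (L a i j 1 - L a i j 0) = exp (C a j - C a i) := by
      rw [exp_sub, exp_sub, (hL a i j hi hj).2, (hL a i j hi hj).2, h0, h1, hC a j hj, hC a i hi]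
    obtain ⟨n, hn⟩ := exp_eq_exp_iff_exists_int.1 he
    exact ⟨n, fun _ _ => hn⟩
  choose n hn using hn
  -- the square of a pair of disjoint paths
  have hsq : ∀ i j k l, i ≠ k → i ≠ l → j ≠ k → j ≠ l →
      (L k i j 1 - L k i j 0) + (L j k l 1 - L j k l 0) =
        (L i k l 1 - L i k l 0) + (L l i j 1 - L l i j 0) := fun i j k l hik hil hjk hjl => by
    obtain ⟨F, hF, hF'⟩ := exists_continuous_exp_eq (A := ℝ × ℝ)
      (f := fun x => γ i j x.1 - γ k l x.2)
      (((hγ i j).comp continuous_fst).sub ((hγ k l).comp continuous_snd))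
      (fun x => sub_ne_zero.2 (hne i j k l hik hil hjk hjl x.1 x.2))
    -- On each side of the unit square one path stands still at an end. Where the first path stands
    -- still the difference is reversed, hence the factor -1.
    have e1 := sub_eq_sub_of_exp_eq_mul (F := fun s : ℝ => F (s, 0)) (by fun_prop)
      (hL k i j hik.symm hjk.symm).1 (c := 1)
      (fun s => by rw [hF', (hL k i j hik.symm hjk.symm).2, h0, one_mul]) 1 0
    have e2 := sub_eq_sub_of_exp_eq_mul (F := fun s : ℝ => F (s, 1)) (by fun_prop)
      (hL l i j hil.symm hjl.symm).1 (c := 1)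
      (fun s => by rw [hF', (hL l i j hil.symm hjl.symm).2, h1, one_mul]) 1 0
    have e3 := sub_eq_sub_of_exp_eq_mul (F := fun t : ℝ => F (0, t)) (by fun_prop)
      (hL i k l hik hil).1 (c := -1)
      (fun s => by rw [hF', (hL i k l hik hil).2, h0]; ring) 1 0
    have e4 := sub_eq_sub_of_exp_eq_mul (F := fun t : ℝ => F (1, t)) (by fun_prop)
      (hL j k l hjk hjl).1 (c := -1)
      (fun s => by rw [hF', (hL j k l hjk hjl).2, h1]; ring) 1 0
    linear_combination -e1 - e4 + e3 + e2
  have hpi : (Real.pi * I : ℂ) ≠ 0 := by simp [Real.pi_ne_zero]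
  let ε : Fin 5 → Fin 5 → ℤ := fun i j => if i < j then -1 else 1
  have hε : ∀ i j, i ≠ j → C i j - C j i = ε i j * (Real.pi * I) := fun i j hij => by
    rcases hij.lt_or_gt with h | h
    · simp [ε, h, hCC i j h]
    · simp [ε, not_lt.2 h.le, hCC j i h]
  have key : ∀ i j k l, i ≠ k → i ≠ l → j ≠ k → j ≠ l →
      2 * (n k i j + n j k l - n i k l - n l i j) + ε k j - ε k i - ε l j + ε l i = 0 := by
    intro i j k l hik hil hjk hjl
    have e := hsq i j k l hik hil hjk hjl
    rw [hn k i j hik.symm hjk.symm, hn j k l hjk hjl, hn i k l hik hil,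
      hn l i j hil.symm hjl.symm] at e
    have a1 := hε k j hjk.symm
    have a2 := hε k i hik.symm
    have a3 := hε l j hjl.symm
    have a4 := hε l i hil.symm
    have : ((2 * (n k i j + n j k l - n i k l - n l i j) + ε k j - ε k i - ε l j + ε l i : ℤ) : ℂ)
        * (Real.pi * I) = 0 := by
      push_cast
      linear_combination e - a1 + a2 + a3 - a4
    exact_mod_cast (mul_eq_zero.1 this).resolve_right hpi
  -- These are the 15 disjoint pairs of edges. Halve the relations and add them mod 2: each `n a i
  -- j` occurs in exactly two, so it cancels. The signs contribute -2 when the two pairs of indices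
  -- interleave and 0 otherwise; there are five interleaving pairs, an odd number.
  have k1 := key 0 1 2 3 (by decide) (by decide) (by decide) (by decide)
  have k2 := key 0 1 2 4 (by decide) (by decide) (by decide) (by decide)
  have k3 := key 0 1 3 4 (by decide) (by decide) (by decide) (by decide)
  have k4 := key 0 2 1 3 (by decide) (by decide) (by decide) (by decide)
  have k5 := key 0 2 1 4 (by decide) (by decide) (by decide) (by decide)
  have k6 := key 0 2 3 4 (by decide) (by decide) (by decide) (by decide)
  have k7 := key 0 3 1 2 (by decide) (by decide) (by decide) (by decide)
  have k8 := key 0 3 1 4 (by decide) (by decide) (by decide) (by decide)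
  have k9 := key 0 3 2 4 (by decide) (by decide) (by decide) (by decide)
  have k10 := key 0 4 1 2 (by decide) (by decide) (by decide) (by decide)
  have k11 := key 0 4 1 3 (by decide) (by decide) (by decide) (by decide)
  have k12 := key 0 4 2 3 (by decide) (by decide) (by decide) (by decide)
  have k13 := key 1 2 3 4 (by decide) (by decide) (by decide) (by decide)
  have k14 := key 1 3 2 4 (by decide) (by decide) (by decide) (by decide)
  have k15 := key 1 4 2 3 (by decide) (by decide) (by decide) (by decide)
  simp only [ε, Fin.reduceLT, if_true, if_false] at *
  clear hn hsq hε key hCC hC hL hne hpγ hp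
  omega

end LogarithmLifts

/-! ### Spread systems of K₅ and plane drawings. -/

namespace SimpleGraph

variable {V : Type u}

/-- Five vertices and walks between them such that walks without a common end have no common
vertex. Every graph with a `K₅` minor has such a system, and it is easier to transport along
contractions than a subdivision of `K₅`. -/
def HasSpreadK5 (G : SimpleGraph V) : Prop :=
  ∃ (v : Fin 5 → V) (w : ∀ i j, G.Walk (v i) (v j)), ∀ i j k l, i ≠ k → i ≠ l → j ≠ k → j ≠ l →
    (w i j).support.Disjoint (w k l).support

namespace PlaneDrawing

variable {G : SimpleGraph V} (D : G.PlaneDrawing)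

/-- The part of a drawing that is spanned by a set of vertices. -/
def carrier (S : Set V) : Set (EuclideanSpace ℝ (Fin 2)) :=
  D.point '' S ∪ ⋃ e : {e : G.edgeSet // ∀ v ∈ (e : Sym2 V), v ∈ S}, Set.range (D.arc e)

theorem disjoint_carrier {S T : Set V} (h : Disjoint S T) :
    Disjoint (D.carrier S) (D.carrier T) := by
  rw [Set.disjoint_left] at h ⊢
  rintro x (⟨v, hv, rfl⟩ | hx) (⟨w, hw, hvw⟩ | hy)
  · exact h hv (D.point_injective hvw ▸ hw)
  · obtain ⟨⟨f, hf⟩, hxf⟩ := Set.mem_iUnion.1 hy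
    exact h hv (hf _ (D.incident_of_point_mem_arc f v hxf))
  · obtain ⟨⟨e, he⟩, hxe⟩ := Set.mem_iUnion.1 hx
    exact h (he _ (D.incident_of_point_mem_arc e w (hvw ▸ hxe))) hw
  · obtain ⟨⟨e, he⟩, hxe⟩ := Set.mem_iUnion.1 hx
    obtain ⟨⟨f, hf⟩, hxf⟩ := Set.mem_iUnion.1 hy
    -- A common edge would put its ends in both vertex sets.
    have hef : e ≠ f := by
      rintro rfl
      obtain ⟨v, hv⟩ : ∃ v, v ∈ (e : Sym2 V) := ⟨_, Sym2.out_fst_mem _⟩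
      exact h (he v hv) (hf v hv)
    obtain ⟨v, hve, hvf, -⟩ := D.common_vertex_of_mem_arcs e f hef x ⟨hxe, hxf⟩
    exact h (he v hve) (hf v hvf)

theorem joinedIn_carrier_of_adj {S : Set V} {a b : V} (hab : G.Adj a b) (ha : a ∈ S)
    (hb : b ∈ S) : JoinedIn (D.carrier S) (D.point a) (D.point b) := by
  let e : G.edgeSet := ⟨s(a, b), hab⟩
  have hsub : Set.range (D.arc e) ⊆ D.carrier S := fun x hx => Or.inr <| Set.mem_iUnion.2
    ⟨⟨e, fun v hv => by rcases Sym2.mem_iff.1 hv with rfl | rfl <;> assumption⟩, hx⟩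
  have hj : JoinedIn (D.carrier S) (D.arc e 0) (D.arc e 1) :=
    ⟨⟨⟨D.arc e, D.arc_continuous e⟩, rfl, rfl⟩, fun t => hsub ⟨t, rfl⟩⟩
  have he := D.arc_ends e
  simp only [e, Sym2.map_mk, Sym2.eq_iff] at he
  rcases he with ⟨h0, h1⟩ | ⟨h0, h1⟩
  · rwa [← h0, ← h1]
  · rw [← h0, ← h1]
    exact hj.symm

theorem joinedIn_carrier_of_walk {S : Set V} {a b : V} (p : G.Walk a b)
    (hp : ∀ v ∈ p.support, v ∈ S) : JoinedIn (D.carrier S) (D.point a) (D.point b) := by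
  induction p with
  | nil => exact JoinedIn.refl (Or.inl ⟨_, hp _ (by simp), rfl⟩)
  | cons h p ih =>
    exact (D.joinedIn_carrier_of_adj h (hp _ (by simp)) (hp _ (by simp))).trans
      (ih fun v hv => hp v (by simp [hv]))

end PlaneDrawing

theorem IsPlanar.not_hasSpreadK5 {G : SimpleGraph V} (hG : G.IsPlanar) : ¬ G.HasSpreadK5 := by
  obtain ⟨D⟩ := hG
  rintro ⟨v, w, hw⟩
  have hj := fun i j => D.joinedIn_carrier_of_walk (S := {x | x ∈ (w i j).support}) (w i j)
    fun _ h => h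
  let φ := Complex.orthonormalBasisOneI.repr.symm
  obtain ⟨i, j, k, l, hik, hil, hjk, hjl, s, t, hst⟩ :=
    exists_disjoint_paths_meet (fun i => φ (D.point (v i)))
      (fun i j t => φ ((hj i j).somePath.extend t))
      (fun i j => φ.continuous.comp (Path.continuous_extend _))
      (fun i j => by simp) (fun i j => by simp)
  have hmem : ∀ i j t, (hj i j).somePath.extend t ∈ D.carrier {x | x ∈ (w i j).support} :=
    fun i j t => (hj i j).somePath_mem _
  refine Set.disjoint_left.1 (D.disjoint_carrier ?_) (hmem i j s) (φ.injective hst ▸ hmem k l t)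
  exact Set.disjoint_left.2 fun x hx hy => hw i j k l hik hil hjk hjl hx hy

/-! ### Transport along minors, and K₅ with a subdivided edge. -/

/-- A system of walks in `H` lifts to `G` along a map whose fibres are connected in `G`. -/
theorem HasSpreadK5.of_map {W : Type u} {G : SimpleGraph V} {H : SimpleGraph W} (φ : V → W)
    (hfib : ∀ a b, φ a = φ b → ∃ p : G.Walk a b, ∀ c ∈ p.support, φ c = φ a)
    (hadj : ∀ x y, H.Adj x y → ∃ a b, φ a = x ∧ φ b = y ∧ G.Adj a b)
    (hsurj : Function.Surjective φ)
    (hH : H.HasSpreadK5) : G.HasSpreadK5 := by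
  obtain ⟨v, w, hw⟩ := hH
  choose r hr using hsurj
  have lift : ∀ x y (q : H.Walk x y) a b, φ a = x → φ b = y →
      ∃ p : G.Walk a b, ∀ c ∈ p.support, φ c ∈ q.support := by
    intro x y q
    induction q with
    | nil =>
      intro a b ha hb
      obtain ⟨p, hp⟩ := hfib a b (ha.trans hb.symm)
      exact ⟨p, fun c hc => by simp [hp c hc, ha]⟩
    | cons h q ih =>
      intro a b ha hb
      obtain ⟨a', b', ha', hb', hab⟩ := hadj _ _ h
      obtain ⟨p, hp⟩ := hfib a a' (ha.trans ha'.symm)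
      obtain ⟨p', hp'⟩ := ih b' b hb' hb
      refine ⟨p.append (p'.cons hab), fun c hc => ?_⟩
      rw [Walk.mem_support_append_iff, Walk.support_cons, List.mem_cons] at hc
      rw [Walk.support_cons, List.mem_cons]
      rcases hc with hc | rfl | hc
      · exact Or.inl ((hp c hc).trans ha)
      · exact Or.inl ha'
      · exact Or.inr (hp' c hc)
  choose w' hw' using fun i j => lift _ _ (w i j) (r (v i)) (r (v j)) (hr _) (hr _)
  refine ⟨fun i => r (v i), w', fun i j k l hik hil hjk hjl x hx hy => ?_⟩
  exact hw i j k l hik hil hjk hjl (hw' i j x hx) (hw' k l x hy)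

theorem HasSpreadK5.mono {G H : SimpleGraph V} (hHG : H ≤ G) (hH : H.HasSpreadK5) :
    G.HasSpreadK5 :=
  hH.of_map id (fun a b h => by obtain rfl : a = b := h; exact ⟨.nil, by simp⟩)
    (fun x y h => ⟨x, y, rfl, rfl, hHG h⟩) Function.surjective_id

theorem HasSpreadK5.of_injective_hom {W : Type u} {G : SimpleGraph V} {H : SimpleGraph W} (f : H →g G)
    (hf : Function.Injective f) (hH : H.HasSpreadK5) : G.HasSpreadK5 := by
  obtain ⟨v, w, hw⟩ := hH
  refine ⟨fun i => f (v i), fun i j => (w i j).map f, fun i j k l hik hil hjk hjl x hx hy => ?_⟩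
  simp only [Walk.support_map, List.mem_map] at hx hy
  obtain ⟨a, ha, rfl⟩ := hx
  obtain ⟨b, hb, hab⟩ := hy
  exact hw i j k l hik hil hjk hjl ha (hf hab ▸ hb)

/-- `K₅`, possibly with the edge `01` replaced by a path of length two. -/
theorem hasSpreadK5_of_adj {G : SimpleGraph V} (v : Fin 5 → V) (hv : Function.Injective v) (c : V)
    (h : ∀ i j, i ≠ j → G.Adj (v i) (v j) ∨
      s(i, j) = s(0, 1) ∧ c ∉ Set.range v ∧ G.Adj (v i) c ∧ G.Adj c (v j)) : G.HasSpreadK5 := by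
  have hw : ∀ i j, ∃ w : G.Walk (v i) (v j), ∀ x ∈ w.support,
      x = v i ∨ x = v j ∨ s(i, j) = s(0, 1) ∧ c ∉ Set.range v ∧ x = c := by
    intro i j
    rcases eq_or_ne i j with rfl | hij
    · exact ⟨.nil, by simp⟩
    rcases h i j hij with h | ⟨h1, h2, h3, h4⟩
    · exact ⟨.cons h .nil, by simp⟩
    · refine ⟨.cons h3 (.cons h4 .nil), fun x hx => ?_⟩
      simp only [Walk.support_cons, Walk.support_nil, List.mem_cons, List.not_mem_nil,
        or_false] at hx
      tauto
  choose w hw using hw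
  refine ⟨v, w, fun i j k l hik hil hjk hjl x hx hy => ?_⟩
  have hne := fun {a b : Fin 5} (hab : a ≠ b) => hv.ne hab
  rcases hw i j x hx with rfl | rfl | ⟨h1, h2, rfl⟩ <;>
  rcases hw k l _ hy with h' | h' | ⟨h3, h4, h'⟩
  · exact hne hik h'
  · exact hne hil h'
  · exact h4 ⟨i, h'⟩
  · exact hne hjk h'
  · exact hne hjl h'
  · exact h4 ⟨j, h'⟩
  · exact h2 ⟨k, h'.symm⟩
  · exact h2 ⟨l, h'.symm⟩
  · rw [← h3, Sym2.eq_iff] at h1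
    tauto

/-! ### Edge counts that force a spread K₅. -/

theorem ncard_edgeSet (G : SimpleGraph V) [Fintype G.edgeSet] :
    G.edgeSet.ncard = G.edgeFinset.card :=
  Set.ncard_eq_toFinset_card' _

open Finset in
open scoped Classical in
theorem ncard_edgeSet_induce_compl_singleton [Fintype V] (G : SimpleGraph V) (u : V) :
    (G.induce {u}ᶜ).edgeSet.ncard = G.edgeSet.ncard - G.degree u := by
  rw [ncard_edgeSet, card_edgeFinset_induce_compl_singleton, card_edgeFinset_deleteIncidenceSet,
    ncard_edgeSet]

open Finset in
open scoped Classical in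
/-- Contracting an edge loses that edge and one edge for each common neighbour of its ends. -/
theorem exists_contraction [Fintype V] {G : SimpleGraph V} {v u : V} (h : G.Adj v u) :
    ∃ H : SimpleGraph ({u}ᶜ : Set V), (H.HasSpreadK5 → G.HasSpreadK5) ∧
      G.edgeSet.ncard ≤ H.edgeSet.ncard + 1 + #(G.neighborFinset v ∩ G.neighborFinset u) := by
  let v' : ({u}ᶜ : Set V) := ⟨v, h.ne⟩
  let φ : V → ({u}ᶜ : Set V) := fun w => if hw : w = u then v' else ⟨w, hw⟩
  have hφu : φ u = v' := by simp [φ]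
  have hφ : ∀ w : ({u}ᶜ : Set V), φ w = w := fun w => dif_neg w.2
  have hφv : φ v = v' := hφ v'
  let H : SimpleGraph ({u}ᶜ : Set V) :=
    { Adj := fun x y => x ≠ y ∧ ∃ a b, φ a = x ∧ φ b = y ∧ G.Adj a b
      symm := ⟨fun x y ⟨hxy, a, b, ha, hb, hab⟩ => ⟨hxy.symm, b, a, hb, ha, hab.symm⟩⟩
      loopless := ⟨fun x hx => hx.1 rfl⟩ }
  refine ⟨H, fun hH => hH.of_map φ ?_ (fun x y (hxy : _ ∧ _) => hxy.2) (fun x => ⟨x, hφ x⟩), ?_⟩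
  · intro a b hab
    by_cases ha : a = u <;> by_cases hb : b = u
    · subst ha hb
      exact ⟨.nil, by simp⟩
    · subst ha
      have : v = b := by simpa [φ, hb, v', Subtype.ext_iff] using hab
      subst this
      exact ⟨.cons h.symm .nil, by simp [hφu, hφv]⟩
    · subst hb
      have : a = v := by simpa [φ, ha, v', Subtype.ext_iff] using hab
      subst this
      exact ⟨.cons h .nil, by simp [hφu, hφv]⟩
    · have : a = b := by simpa [φ, ha, hb, Subtype.ext_iff] using hab
      subst this
      exact ⟨.nil, by simp⟩
  · have hdeg := G.ncard_edgeSet_induce_compl_singleton u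
    -- Each vertex of `B` gains an edge to `v'` that is absent from `G` without `u`.
    let B : Finset ({u}ᶜ : Set V) :=
      Finset.subtype (· ∈ ({u}ᶜ : Set V)) ((G.neighborFinset u \ G.neighborFinset v).erase v)
    have hB : ∀ w, w ∈ B ↔ (w : V) ≠ v ∧ G.Adj u w ∧ ¬ G.Adj v w := by simp [B]
    have hBcard : #B + 1 + #(G.neighborFinset v ∩ G.neighborFinset u) = G.degree u := by
      have hsub : (G.neighborFinset u \ G.neighborFinset v).erase v ⊆ {u}ᶜ := by
        intro w hw
        simp only [mem_erase, mem_sdiff, mem_neighborFinset] at hw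
        simpa using hw.2.1.ne'
      rw [card_subtype, filter_true_of_mem (fun w hw => by simpa using hsub hw),
        card_erase_add_one (by simp [h.symm]), inter_comm, card_sdiff_add_card_inter,
        card_neighborFinset_eq_degree]
    have hunion : (G.induce {u}ᶜ).edgeFinset ∪ B.image (fun w => s(v', w)) ⊆ H.edgeFinset := by
      intro e he
      rw [mem_union, mem_image] at he
      rcases he with he | ⟨w, hw, rfl⟩
      · induction e with | _ a b =>
        rw [mem_edgeFinset, mem_edgeSet] at he ⊢
        exact ⟨he.ne, a, b, hφ a, hφ b, he⟩
      · rw [mem_edgeFinset, mem_edgeSet]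
        obtain ⟨h1, h2, h3⟩ := (hB w).1 hw
        exact ⟨fun h' => h1 (congrArg Subtype.val h').symm, u, w, hφu, hφ w, h2⟩
    have hdisj : Disjoint (G.induce {u}ᶜ).edgeFinset (B.image (fun w => s(v', w))) := by
      refine Finset.disjoint_left.2 fun e he he' => ?_
      obtain ⟨w, hw, rfl⟩ := mem_image.1 he'
      rw [mem_edgeFinset, mem_edgeSet] at he
      exact ((hB w).1 hw).2.2 he
    have hcard := card_le_card hunion
    rw [card_union_of_disjoint hdisj,
      card_image_of_injective _ (fun a b hab => Sym2.congr_right.1 hab),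
      ← ncard_edgeSet, ← ncard_edgeSet] at hcard
    omega

/-- The branch vertices are `a, b, c, d, v`; the path through `e` stands in for the edge from `a` to
`b`. -/
theorem hasSpreadK5_of_subdivided {G : SimpleGraph V} {a b c d e v : V} (hab : a ≠ b)
    (hac : G.Adj a c) (had : G.Adj a d) (hae : G.Adj a e) (hbc : G.Adj b c) (hbd : G.Adj b d)
    (hbe : G.Adj b e) (hcd : G.Adj c d) (hce : c ≠ e) (hde : d ≠ e) (hva : G.Adj v a)
    (hvb : G.Adj v b) (hvc : G.Adj v c) (hvd : G.Adj v d) (hve : G.Adj v e) :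
    G.HasSpreadK5 := by
  have hnot : e ∉ Set.range ![a, b, c, d, v] := by
    rintro ⟨i, hi⟩
    fin_cases i
    exacts [hae.ne hi, hbe.ne hi, hce hi, hde hi, hve.ne hi]
  refine hasSpreadK5_of_adj ![a, b, c, d, v] ?_ e ?_
  · intro i j hij
    fin_cases i <;> fin_cases j <;> first
      | rfl
      | (exfalso; revert hij; simp [hab, hab.symm, hac.ne, hac.ne', had.ne, had.ne', hbc.ne,
          hbc.ne', hbd.ne, hbd.ne', hcd.ne, hcd.ne', hva.ne, hva.ne', hvb.ne, hvb.ne', hvc.ne,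
          hvc.ne', hvd.ne, hvd.ne'])
  · intro i j hij
    fin_cases i <;> fin_cases j <;> first
      | exact absurd rfl hij
      | exact Or.inl (by first | assumption | exact G.adj_symm (by assumption))
      | exact Or.inr ⟨rfl, hnot, hae, hbe.symm⟩
      | exact Or.inr ⟨Sym2.eq_swap, hnot, hbe, hae.symm⟩

open Finset in
open scoped Classical in
-- If the neighbourhood of `v` is a clique, four of its vertices and `v` form K₅. Otherwise it has
-- five vertices and its non-edges form a matching; the ends of one non-edge are joined through one
-- of the other three vertices, chosen so that the remaining two are adjacent.
theorem hasSpreadK5_of_neighbors [Fintype V] {G : SimpleGraph V} {v : V} (h4 : 4 ≤ G.degree v)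
    (h5 : G.degree v ≤ 5)
    (h3 : ∀ u, G.Adj v u → 3 ≤ #(G.neighborFinset v ∩ G.neighborFinset u)) : G.HasSpreadK5 := by
  set S := G.neighborFinset v with hS
  have hSv : ∀ x, x ∈ S ↔ G.Adj v x := by simp [hS]
  have hcard : #S = G.degree v := G.card_neighborFinset_eq_degree v
  -- The set `S \ G.neighborFinset u` contains `u` itself, so at most one other vertex fits when `#S
  -- = 5`, and none when `#S = 4`.
  have hsd : ∀ u ∈ S, #(S \ G.neighborFinset u) + 3 ≤ #S := fun u hu => by
    have := h3 u ((hSv u).1 hu)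
    have := card_sdiff_add_card_inter S (G.neighborFinset u)
    omega
  have hmem : ∀ u x, x ∈ S \ G.neighborFinset u ↔ x ∈ S ∧ ¬ G.Adj u x := by simp
  by_cases hcl : ∀ a ∈ S, ∀ b ∈ S, a ≠ b → G.Adj a b
  · obtain ⟨f⟩ : Nonempty (Fin 4 ↪ S) :=
      Function.Embedding.nonempty_of_card_le (by simpa [hcard] using h4)
    have hadj : ∀ i j : Fin 5, i ≠ j →
        G.Adj ((Fin.cons v fun i => (f i : V) : Fin 5 → V) i)
          ((Fin.cons v fun i => (f i : V) : Fin 5 → V) j) := by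
      intro i j
      refine Fin.cases (Fin.cases (fun h => absurd rfl h) (fun j _ => ?_) j)
        (fun i => Fin.cases (fun _ => ?_) (fun j hij => ?_) j) i
      · exact (hSv _).1 (f j).2
      · exact ((hSv _).1 (f i).2).symm
      · refine hcl _ (f i).2 _ (f j).2 fun h => hij ?_
        rw [f.injective (Subtype.ext h)]
    refine hasSpreadK5_of_adj _ (fun i j hij => ?_) v fun i j hij => Or.inl (hadj i j hij)
    by_contra hne
    exact (hadj i j hne).ne hij
  · push Not at hcl
    obtain ⟨a, ha, b, hb, hab, hnab⟩ := hcl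
    -- a vertex of `S` has at most one non-neighbour in `S`
    have huniq : ∀ u ∈ S, ∀ x ∈ S, ∀ y ∈ S, u ≠ x → u ≠ y → x ≠ y →
        ¬ G.Adj u x → G.Adj u y := by
      intro u hu x hx y hy hux huy hxy hnx
      by_contra hny
      have h1 : ({u, x, y} : Finset V) ⊆ S \ G.neighborFinset u := by
        intro z hz
        simp only [mem_insert, mem_singleton] at hz
        rw [hmem]
        rcases hz with rfl | rfl | rfl
        exacts [⟨hu, G.loopless.irrefl _⟩, ⟨hx, hnx⟩, ⟨hy, hny⟩]
      have h2 := card_le_card h1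
      rw [card_eq_three.2 ⟨u, x, y, hux, huy, hxy, rfl⟩] at h2
      have := hsd u hu
      omega
    have hS5 : #S = 5 := by
      have h1 : ({a, b} : Finset V) ⊆ S \ G.neighborFinset a := by
        intro z hz
        simp only [mem_insert, mem_singleton] at hz
        rw [hmem]
        rcases hz with rfl | rfl
        exacts [⟨ha, G.loopless.irrefl _⟩, ⟨hb, hnab⟩]
      have h2 := card_le_card h1
      rw [card_pair hab] at h2
      have := hsd a ha
      omega
    obtain ⟨c, d, e, hcd, hce, hde, hcde⟩ := card_eq_three.1
      (show #((S.erase a).erase b) = 3 by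
        rw [card_erase_of_mem (by simp [hab.symm, hb]), card_erase_of_mem ha, hS5])
    have hR : ∀ x ∈ ({c, d, e} : Finset V), x ∈ S ∧ a ≠ x ∧ b ≠ x ∧ G.Adj a x ∧ G.Adj b x ∧
        G.Adj v x := by
      intro x hx
      rw [← hcde, mem_erase, mem_erase] at hx
      obtain ⟨hxb, hxa, hxS⟩ := hx
      exact ⟨hxS, hxa.symm, hxb.symm, huniq a ha b hb x hxS hab hxa.symm hxb.symm hnab,
        huniq b hb a ha x hxS hab.symm hxb.symm hxa.symm (fun h => hnab h.symm), (hSv x).1 hxS⟩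
    obtain ⟨hcS, -, -, hac, hbc, hvc⟩ := hR c (by simp)
    obtain ⟨hdS, -, -, had, hbd, hvd⟩ := hR d (by simp)
    obtain ⟨heS, -, -, hae, hbe, hve⟩ := hR e (by simp)
    have hva := (hSv a).1 ha
    have hvb := (hSv b).1 hb
    by_cases h : G.Adj c d
    · exact hasSpreadK5_of_subdivided hab hac had hae hbc hbd hbe h hce hde hva hvb hvc hvd hve
    · exact hasSpreadK5_of_subdivided hab hac hae had hbc hbe hbd
        (huniq c hcS d hdS e heS hcd hce hde h) hcd hde.symm hva hvb hvc hve hvd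

open Finset in
open scoped Classical in
/-- A graph with at least `3n - 3` edges has a `K₅` minor, hence a spread `K₅`. -/
theorem hasSpreadK5_of_ncard_edgeSet (n : ℕ) : ∀ (V : Type u) [Fintype V] (G : SimpleGraph V),
    Fintype.card V = n → 2 ≤ n → 3 * n ≤ G.edgeSet.ncard + 3 → G.HasSpreadK5 := by
  induction n with
  | zero => omega
  | succ n ih =>
    intro V _ G₀ hn hn2 hE₀
    -- With exactly 3n edges on n + 1 vertices the average degree is below 6.
    obtain ⟨G, hG, hE⟩ : ∃ G ≤ G₀, G.edgeSet.ncard = 3 * n := by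
      obtain ⟨s, hs, hscard⟩ := Set.exists_subset_card_eq (s := G₀.edgeSet) (n := 3 * n) (by omega)
      refine ⟨fromEdgeSet s, fun a b hab => hs ((fromEdgeSet_adj _).1 hab).1, ?_⟩
      rw [← hscard, edgeSet_fromEdgeSet, Disjoint.sdiff_eq_left]
      exact Set.disjoint_left.2 fun e he hd => G₀.not_isDiag_of_mem_edgeSet (hs he) hd
    refine HasSpreadK5.mono hG ?_
    have hcompl : ∀ u : V, Fintype.card ({u}ᶜ : Set V) = n := fun u => by
      rw [Fintype.card_compl_set, hn]; simp
    -- Two vertices cannot carry three edges, so the induction ends in a contradiction. A single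
    -- vertex must be excluded: it meets the bound with no edges.
    have hn3 : 2 ≤ n := by
      by_contra hlt
      obtain rfl : n = 1 := by omega
      have := card_edgeFinset_le_card_choose_two (G := G)
      rw [← ncard_edgeSet, hE, hn] at this
      norm_num at this
    obtain ⟨v, -, hv⟩ : ∃ v ∈ (univ : Finset V), G.degree v < 6 := by
      refine exists_lt_of_sum_lt ?_
      rw [G.sum_degrees_eq_twice_card_edges, ← ncard_edgeSet, hE, sum_const, card_univ, hn, smul_eq_mul]
      omega
    -- Deleting `v`, or contracting an edge whose ends have at most two common neighbours, loses at
    -- most three edges.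
    by_cases hdeg : G.degree v ≤ 3
    · have hc := G.ncard_edgeSet_induce_compl_singleton v
      exact HasSpreadK5.of_injective_hom (Embedding.induce _).toHom Subtype.val_injective
        (ih _ (G.induce {v}ᶜ) (hcompl v) hn3 (by omega))
    by_cases hu : ∃ u, G.Adj v u ∧ #(G.neighborFinset v ∩ G.neighborFinset u) ≤ 2
    · obtain ⟨u, hvu, hcommon⟩ := hu
      obtain ⟨H, hHG, hH⟩ := exists_contraction hvu
      exact hHG (ih _ H (hcompl u) hn3 (by omega))
    · push Not at hu
      exact hasSpreadK5_of_neighbors (by omega) (by omega) fun u hvu => hu u hvu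

/-! ### Averaging edge densities over spanning trees. -/

open Finset in
open scoped Classical in
/-- Every spanning tree has `n - 1` edges: count the pairs of a spanning tree and an edge of it. -/
theorem sum_numSpanningTreesThrough [Fintype V] (G : SimpleGraph V) :
    ∑ e ∈ G.edgeFinset, G.numSpanningTreesThrough e =
      (Fintype.card V - 1) * G.numSpanningTrees := by
  have h := sum_card_bipartiteAbove_eq_sum_card_bipartiteBelow
    (s := G.edgeFinset) (t := G.spanningTrees.toFinset)
    (fun (e : Sym2 V) (T : SimpleGraph V) => e ∈ T.edgeSet)
  have h1 : ∀ e, G.numSpanningTreesThrough e =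
      #(bipartiteAbove (fun (e : Sym2 V) (T : SimpleGraph V) => e ∈ T.edgeSet)
        G.spanningTrees.toFinset e) := fun e => by
    rw [numSpanningTreesThrough, Set.ncard_eq_toFinset_card']
    congr 1
    ext T
    rw [Set.mem_toFinset]
    simp [spanningTreesThrough, bipartiteAbove]
  have h2 : ∀ T ∈ G.spanningTrees.toFinset,
      #(bipartiteBelow (fun (e : Sym2 V) (T : SimpleGraph V) => e ∈ T.edgeSet) G.edgeFinset T) =
        Fintype.card V - 1 := fun T hT => by
    obtain ⟨hTG, hT⟩ := Set.mem_toFinset.1 hT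
    rw [← hT.card_edgeFinset, Nat.add_sub_cancel]
    congr 1
    ext e
    simpa [bipartiteBelow] using fun he => edgeSet_mono hTG he
  simp_rw [h1]
  rw [h, sum_congr rfl h2, sum_const, smul_eq_mul, mul_comm, numSpanningTrees,
    Set.ncard_eq_toFinset_card']

theorem numSpanningTrees_pos [Finite V] {G : SimpleGraph V} (hG : G.Connected) :
    0 < G.numSpanningTrees := by
  obtain ⟨T, hT⟩ := hG.exists_isTree_le
  exact (Set.ncard_pos (Set.toFinite _)).2 ⟨T, hT⟩

/-- Some edge has at least the average density `(n - 1) / |E|`. -/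
theorem card_sub_one_le_ncard_edgeSet_mul_dep [Fintype V] {G : SimpleGraph V} (hG : G.Connected) :
    ((Fintype.card V - 1 : ℕ) : ℝ) ≤ G.edgeSet.ncard * G.dep := by
  classical
  have hpos : (0 : ℝ) < G.numSpanningTrees := by exact_mod_cast numSpanningTrees_pos hG
  have hle : ∀ e ∈ G.edgeFinset,
      (G.numSpanningTreesThrough e : ℝ) ≤ G.dep * G.numSpanningTrees := fun e he => by
    have he' := mem_edgeFinset.1 he
    exact (div_le_iff₀ hpos).1 ((G.isGreatest_dep ⟨e, he'⟩).2 ⟨e, he', rfl⟩)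
  have hsum := Finset.sum_le_sum hle
  rw [← Nat.cast_sum, sum_numSpanningTreesThrough, Finset.sum_const, nsmul_eq_mul,
    ← ncard_edgeSet, Nat.cast_mul, ← mul_assoc] at hsum
  exact le_of_mul_le_mul_right hsum hpos

theorem IsPlanar.one_third_lt_dep [Fintype V] {G : SimpleGraph V} (hV : 2 ≤ Fintype.card V)
    (hG : G.Connected) (hp : G.IsPlanar) : 1 / 3 < G.dep := by
  by_contra! hdep
  have h := card_sub_one_le_ncard_edgeSet_mul_dep hG
  have h' : ((Fintype.card V - 1 : ℕ) : ℝ) * 3 ≤ G.edgeSet.ncard := by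
    nlinarith [Nat.cast_nonneg (α := ℝ) G.edgeSet.ncard]
  have h'' : (Fintype.card V - 1) * 3 ≤ G.edgeSet.ncard := by exact_mod_cast h'
  exact hp.not_hasSpreadK5 (hasSpreadK5_of_ncard_edgeSet _ V G rfl hV (by omega))

end SimpleGraph

theorem theorem3 :
    (∀ (V : Type u) [Fintype V] (G : SimpleGraph V),
      2 ≤ Fintype.card V → G.Connected → G.IsPlanar → 1 / 3 < G.dep) ∧
    (∀ r : ℚ, r ≤ 1 / 3 → ¬ IsPlanarDependence.{u} (r : ℝ)) ∧
    ¬ (∀ p q : ℕ, 0 < p → p < q → IsPlanarDependence.{u} ((p : ℝ) / (q : ℝ))) := by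
  refine ⟨fun V _ G hV hG hp => hp.one_third_lt_dep hV hG, ?_, fun h => ?_⟩
  · rintro r hr ⟨V, _, G, hV, hG, hp, hdep⟩
    have h1 := hp.one_third_lt_dep hV hG
    have h2 : (r : ℝ) ≤ ((1 / 3 : ℚ) : ℝ) := by exact_mod_cast hr
    rw [hdep] at h1
    push_cast at h2
    linarith
  · obtain ⟨V, _, G, hV, hG, hp, hdep⟩ := h 1 3 one_pos (by norm_num)
    have h1 := hp.one_third_lt_dep hV hG
    rw [hdep] at h1
    norm_num at h1
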